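/- Let $d\in\{1,2,3\}$ and let $O\subset\mathbb R^d$ be a convex bounded (Lipschitz) domain with polygonal boundary, i.e. a nonempty convex open set whose closure is the convex hull of finitely many points. Let $O_h$ be a triangulation of $O$, i.e. a finite collection of closed nondegenerate $d$-simplices $K$ with union $\overline O$ such that any two of them are disjoint or meet exactly in a common face. Let $u:\overline O\to\mathbb R^d$ be continuous with $u|_{K}\in H^3(\operatorname{int}K)^d$ for every $K\in O_h$, i.e. for every $K$ each component of $u$ has weak partial derivatives of all orders at most $3$ in $L^2(\operatorname{int} K)$. Then $u\in W^{1,\infty}(O)^d$, i.e. each component of $u$ is essentially bounded on $O$ and has essentially bounded weak first partial derivatives on $O$; moreover $u$ is Lipschitz continuous on $\overline O$. -/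

import Mathlib

open MeasureTheory Set
open scoped ENNReal NNReal ContDiff

noncomputable section

/-- The `n`-th order partial derivative `∂_{i 0} ⋯ ∂_{i (n-1)} φ` in the standard coordinates of
`ℝ^d`. A tuple `i : Fin n → Fin d` stands for the multi-index `α` of order `|α| = n` whose entry
`α_j` is the number of `k` with `i k = j`; for smooth `φ` the order of the entries is irrelevant. -/
def partialDeriv {d n : ℕ} (i : Fin n → Fin d) (φ : EuclideanSpace ℝ (Fin d) → ℝ)
    (x : EuclideanSpace ℝ (Fin d)) : ℝ :=
  iteratedFDeriv ℝ n φ x fun k => EuclideanSpace.single (i k) 1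

/-- `g` is the weak derivative `∂_{i 0} ⋯ ∂_{i (n-1)} f` on the open set `U`. -/
structure HasWeakDerivOn {d n : ℕ} (U : Set (EuclideanSpace ℝ (Fin d))) (i : Fin n → Fin d)
    (f g : EuclideanSpace ℝ (Fin d) → ℝ) : Prop where
  locallyIntegrableOn_left : LocallyIntegrableOn f U
  locallyIntegrableOn_right : LocallyIntegrableOn g U
  integral_eq : ∀ φ : EuclideanSpace ℝ (Fin d) → ℝ,
    ContDiff ℝ ∞ φ → HasCompactSupport φ → tsupport φ ⊆ U →
      ∫ x in U, f x * partialDeriv i φ x = (-1) ^ n * ∫ x in U, g x * φ x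

/-- `f` belongs to the Sobolev space `W^{k,p}(U)` of the open set `U`: `f` is in `L^p(U)` and all
its weak partial derivatives of order at most `k` exist and are in `L^p(U)`. -/
def MemSobolev {d : ℕ} (k : ℕ) (p : ℝ≥0∞) (U : Set (EuclideanSpace ℝ (Fin d)))
    (f : EuclideanSpace ℝ (Fin d) → ℝ) : Prop :=
  MemLp f p (volume.restrict U) ∧
    ∀ n ≤ k, ∀ i : Fin n → Fin d, ∃ g : EuclideanSpace ℝ (Fin d) → ℝ,
      MemLp g p (volume.restrict U) ∧ HasWeakDerivOn U i f g

/-- A vector field is in `W^{k,p}(U)^d` if each of its components is in `W^{k,p}(U)`. -/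
def MemSobolevVec {d : ℕ} (k : ℕ) (p : ℝ≥0∞) (U : Set (EuclideanSpace ℝ (Fin d)))
    (u : EuclideanSpace ℝ (Fin d) → EuclideanSpace ℝ (Fin d)) : Prop :=
  ∀ j : Fin d, MemSobolev k p U fun x => u x j

/-- A convex bounded domain of `ℝ^d` with polygonal (polyhedral) boundary: a nonempty convex open
set whose closure is a convex polytope, i.e. the convex hull of finitely many points. Such a set is
bounded, connected, and has a Lipschitz boundary. -/
structure IsConvexPolygonalDomain {d : ℕ} (O : Set (EuclideanSpace ℝ (Fin d))) : Prop where
  isOpen : IsOpen O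
  nonempty : O.Nonempty
  convex : Convex ℝ O
  polytope : ∃ P : Finset (EuclideanSpace ℝ (Fin d)), closure O = convexHull ℝ (P : Set _)

/-- The simplicial complex `T` (simplices that meet only in common faces) is a triangulation of `O`:
it is finite, its simplices cover exactly the closure of `O`, and each of them is a face of a
`d`-dimensional simplex of `T`. -/
structure IsTriangulation {d : ℕ} (T : Geometry.SimplicialComplex ℝ (EuclideanSpace ℝ (Fin d)))
    (O : Set (EuclideanSpace ℝ (Fin d))) : Prop where
  finite : T.faces.Finite
  space_eq : T.space = closure O
  pure : ∀ s ∈ T.faces, ∃ t ∈ T.faces, s ⊆ t ∧ t.card = d + 1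

/-- The elements `K` of a triangulation: its closed `d`-dimensional simplices. -/
def triangulationElements {d : ℕ} (T : Geometry.SimplicialComplex ℝ (EuclideanSpace ℝ (Fin d))) :
    Set (Set (EuclideanSpace ℝ (Fin d))) :=
  {K | ∃ s ∈ T.faces, s.card = d + 1 ∧ K = convexHull ℝ (s : Set (EuclideanSpace ℝ (Fin d)))}

end

/-! The heart is the Sobolev embedding `H² ⊂ L^∞` in dimension at most three, applied to the
gradient of `u` on one simplex `K`. Mollify a component of `u` and let `w` be a first partial
derivative of the result. Taylor's formula along the segment from `x` to `y`, expanded at `y`,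
bounds `w x` by `w y`, `∇w y` and `∫ s |D²w (x + s (y - x))| ds`. Average over `y` in a fixed ball
`B`. Cauchy–Schwarz and the dilation by `s` turn the last term into `∫ s · s^(-d/2) ds` times an
`L²` norm of third derivatives, and this integral converges because `d < 4`
(`enorm_coordDeriv_mollify_mul_le`).

The bound does not depend on the mollifier, so the mean value inequality and a passage to the limit
make `u` Lipschitz on `interior K` (`MemSobolev.exists_lipschitzOnWith`), hence on `K` by
continuity. A segment in the convex set `closure O` crosses only finitely many closed pieces, so the
largest of the constants serves globally (`LipschitzOnWith.of_finite_closed_cover`). A Lipschitz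
function on a bounded open set lies in `W^{1,∞}` (`LipschitzOnWith.memSobolev_one_top`). -/

/-! ### Gluing Lipschitz bounds along segments -/

/-- A continuous function on a convex set covered by finitely many closed sets is `L`-Lipschitz as
soon as it is `L`-Lipschitz on each piece. -/
theorem LipschitzOnWith.of_finite_closed_cover {E F : Type*} [NormedAddCommGroup E]
    [NormedSpace ℝ E] [PseudoMetricSpace F] {S : Set E} (hS : Convex ℝ S) {u : E → F}
    (hu : ContinuousOn u S) {C : Set (Set E)} (hC : C.Finite) (hcl : ∀ K ∈ C, IsClosed K)
    (hcov : S ⊆ ⋃₀ C) {L : ℝ≥0} (hL : ∀ K ∈ C, LipschitzOnWith L u (K ∩ S)) :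
    LipschitzOnWith L u S := by
  refine LipschitzOnWith.of_dist_le_mul fun x hx y hy => ?_
  set γ : ℝ → E := fun t => x + t • (y - x) with hγ
  have hγc : Continuous γ := by fun_prop
  have hγS : ∀ t ∈ Icc (0 : ℝ) 1, γ t ∈ S := fun t ht => hS.add_smul_sub_mem hx hy ht
  have hγd : ∀ s t : ℝ, dist (γ s) (γ t) = |s - t| * dist x y := by
    intro s t
    rw [dist_add_left, dist_eq_norm, ← sub_smul, norm_smul, Real.norm_eq_abs, dist_comm x,
      dist_eq_norm]
  have huγ : ContinuousOn (fun t => u (γ t)) (Icc 0 1) := hu.comp hγc.continuousOn hγS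
  -- Continuous induction on the segment: the estimate measured from the starting point is a closed
  -- condition on `t` and can always be pushed a little to the right.
  let s : Set ℝ := {t | dist (u (γ 0)) (u (γ t)) ≤ L * (t * dist x y)}
  have key : Icc (0 : ℝ) 1 ⊆ s := by
    refine IsClosed.Icc_subset_of_forall_exists_gt ?_ ?_ ?_
    · have hcl := (continuous_dist.comp_continuousOn
        ((continuousOn_const (c := u (γ 0))).prodMk huγ)).sub
        (Continuous.continuousOn (by fun_prop : Continuous fun t : ℝ => L * (t * dist x y)))
      have := hcl.preimage_isClosed_of_isClosed isClosed_Icc (isClosed_Iic (a := (0 : ℝ)))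
      convert this using 1
      ext t
      simp [s, and_comm]
    · simp [s]
    · rintro t ⟨hts, ht0, ht1⟩ y' hy'
      have ht1' : t < min y' 1 := lt_min hy' ht1
      -- some piece contains points of the segment arbitrarily close to the right of `t`
      obtain ⟨K, hK, hKf⟩ : ∃ K ∈ C, ∃ᶠ r in nhdsWithin t (Ioi t), γ r ∈ K := by
        by_contra! hcon
        have h1 : ∀ᶠ r in nhdsWithin t (Ioi t), ∀ K ∈ C, γ r ∉ K :=
          (Filter.eventually_all_finite hC).2 fun K hK => hcon K hK
        have h2 : ∀ᶠ r in nhdsWithin t (Ioi t), r ∈ Ioo t 1 := Ioo_mem_nhdsGT ht1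
        obtain ⟨r, hr1, hr2⟩ := (h1.and h2).exists
        obtain ⟨K, hK, hrK⟩ := hcov (hγS r ⟨ht0.trans hr2.1.le, hr2.2.le⟩)
        exact hr1 K hK hrK
      -- Closedness puts `γ t` into the same piece as the later points `γ r`, so the bound on that
      -- piece compares the two.
      have htK : γ t ∈ K := by
        have : IsClosed (γ ⁻¹' K) := (hcl K hK).preimage hγc
        exact this.mem_of_frequently_of_tendsto hKf (Filter.tendsto_id.mono_left nhdsWithin_le_nhds)
      obtain ⟨r, hrK, hr⟩ := (hKf.and_eventually (Ioo_mem_nhdsGT ht1')).exists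
      have hr1 : r ≤ 1 := (hr.2.trans_le (min_le_right _ _)).le
      refine ⟨r, ?_, hr.1, (hr.2.trans_le (min_le_left _ _)).le⟩
      have h3 := (hL K hK).dist_le_mul (γ t) ⟨htK, hγS t ⟨ht0, ht1.le⟩⟩ (γ r)
        ⟨hrK, hγS r ⟨ht0.trans hr.1.le, hr1⟩⟩
      rw [hγd, abs_sub_comm, abs_of_pos (sub_pos.2 hr.1)] at h3
      have h4 : dist (u (γ 0)) (u (γ t)) ≤ L * (t * dist x y) := hts
      have h5 := dist_triangle (u (γ 0)) (u (γ t)) (u (γ r))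
      change dist (u (γ 0)) (u (γ r)) ≤ L * (r * dist x y)
      nlinarith
  have := key (right_mem_Icc.2 zero_le_one)
  simpa [s, hγ] using this

/-! ### Elements of a triangulation -/

/-- The elements of a triangulation are compact convex sets with nonempty interior. -/
theorem isConvexBody_of_mem_triangulationElements {d : ℕ}
    {T : Geometry.SimplicialComplex ℝ (EuclideanSpace ℝ (Fin d))}
    {K : Set (EuclideanSpace ℝ (Fin d))} (hK : K ∈ triangulationElements T) :
    Convex ℝ K ∧ IsCompact K ∧ (interior K).Nonempty := by
  obtain ⟨s, hs, hcard, rfl⟩ := hK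
  refine ⟨convex_convexHull _ _, s.finite_toSet.isCompact_convexHull ℝ, ?_⟩
  rw [interior_convexHull_nonempty_iff_affineSpan_eq_top]
  have h := (T.indep hs).affineSpan_eq_top_iff_card_eq_finrank_add_one
  rw [Subtype.range_coe] at h
  exact h.2 (by simp [hcard])

theorem IsTriangulation.finite_elements {d : ℕ}
    {T : Geometry.SimplicialComplex ℝ (EuclideanSpace ℝ (Fin d))}
    {O : Set (EuclideanSpace ℝ (Fin d))} (hT : IsTriangulation T O) :
    (triangulationElements T).Finite := by
  refine (Set.Finite.image (fun s : Finset (EuclideanSpace ℝ (Fin d)) =>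
    convexHull ℝ (s : Set (EuclideanSpace ℝ (Fin d)))) hT.finite).subset ?_
  rintro K ⟨s, hs, -, rfl⟩
  exact ⟨s, hs, rfl⟩

theorem IsTriangulation.sUnion_elements {d : ℕ}
    {T : Geometry.SimplicialComplex ℝ (EuclideanSpace ℝ (Fin d))}
    {O : Set (EuclideanSpace ℝ (Fin d))} (hT : IsTriangulation T O) :
    ⋃₀ triangulationElements T = closure O := by
  rw [← hT.space_eq]
  ext x
  rw [Geometry.SimplicialComplex.mem_space_iff]
  constructor
  · rintro ⟨K, ⟨s, hs, -, rfl⟩, hx⟩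
    exact ⟨s, hs, hx⟩
  · rintro ⟨s, hs, hx⟩
    obtain ⟨t, ht, hst, hcard⟩ := hT.pure s hs
    exact ⟨_, ⟨t, ht, hcard, rfl⟩, convexHull_mono (by exact_mod_cast hst) hx⟩

/-! ### Lipschitz functions and weak first derivatives -/

theorem partialDeriv_zero {d : ℕ} (i : Fin 0 → Fin d) (φ : EuclideanSpace ℝ (Fin d) → ℝ) :
    partialDeriv i φ = φ := by
  ext x; simp [partialDeriv]

theorem partialDeriv_one {d : ℕ} (i : Fin 1 → Fin d) (φ : EuclideanSpace ℝ (Fin d) → ℝ)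
    (x : EuclideanSpace ℝ (Fin d)) :
    partialDeriv i φ x = fderiv ℝ φ x (EuclideanSpace.single (i 0) 1) := by
  simp [partialDeriv]

/-- A Lipschitz function on a bounded open set is in `W^{1,∞}`. -/
theorem LipschitzOnWith.memSobolev_one_top {d : ℕ} {O : Set (EuclideanSpace ℝ (Fin d))}
    (hO : IsOpen O) (hb : Bornology.IsBounded O) {f : EuclideanSpace ℝ (Fin d) → ℝ} {L : ℝ≥0}
    (hf : LipschitzOnWith L f O) : MemSobolev 1 ∞ O f := by
  -- Extending to the whole space makes the line derivative of `F` bounded almost everywhere and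
  -- allows integration by parts against test functions; those supported in `O` see only `f`.
  obtain ⟨F, hF, hfF⟩ := hf.extend_real
  have hfL : MemLp f ∞ (volume.restrict O) := by
    obtain ⟨C, hC⟩ := (hF.isBounded_image hb).exists_norm_le
    refine memLp_top_of_bound (hf.continuousOn.aestronglyMeasurable hO.measurableSet) C ?_
    filter_upwards [ae_restrict_mem hO.measurableSet] with x hx
    exact hfF hx ▸ hC _ (mem_image_of_mem F hx)
  have hfloc : LocallyIntegrableOn f O :=
    hf.continuousOn.locallyIntegrableOn hO.measurableSet
  have hext : ∀ g : EuclideanSpace ℝ (Fin d) → ℝ, (∀ x ∉ O, g x = 0) →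
      ∫ x in O, g x = ∫ x, g x := fun g hg => setIntegral_eq_integral_of_forall_compl_eq_zero hg
  refine ⟨hfL, fun n hn i => ?_⟩
  obtain rfl | rfl : n = 0 ∨ n = 1 := by omega
  · exact ⟨f, hfL, hfloc, hfloc, fun φ _ _ _ => by simp [partialDeriv_zero]⟩
  · set v : EuclideanSpace ℝ (Fin d) := EuclideanSpace.single (i 0) 1
    have hg := hF.memLp_lineDeriv (μ := volume) v
    refine ⟨fun x => lineDeriv ℝ F x v, hg.restrict O, hfloc,
      (hg.locallyIntegrable le_top).locallyIntegrableOn O, fun φ hφ hφc hφO => ?_⟩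
    obtain ⟨D, hD⟩ := (hφ.of_le (by exact_mod_cast le_top)).lipschitzWith_of_hasCompactSupport
      hφc one_ne_zero
    have hφ0 : ∀ x ∉ O, φ x = 0 := fun x hx => image_eq_zero_of_notMem_tsupport fun h => hx (hφO h)
    have hφ0' : ∀ x ∉ O, fderiv ℝ φ x = 0 := fun x hx =>
      image_eq_zero_of_notMem_tsupport fun h => hx (hφO (tsupport_fderiv_subset ℝ h))
    have e1 : ∫ x in O, f x * partialDeriv i φ x = ∫ x, F x * fderiv ℝ φ x v := by
      rw [← hext (fun x => F x * fderiv ℝ φ x v) fun x hx => by simp [hφ0' x hx]]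
      refine setIntegral_congr_fun hO.measurableSet fun x hx => ?_
      simp only [partialDeriv_one, hfF hx, v]
    have e2 : ∫ x in O, lineDeriv ℝ F x v * φ x = ∫ x, lineDeriv ℝ F x v * φ x :=
      hext _ fun x hx => by simp [hφ0 x hx]
    rw [e1, e2, hF.integral_lineDeriv_mul_eq hD hφc v, pow_one, neg_one_mul, ← integral_neg]
    refine integral_congr_ae (Filter.Eventually.of_forall fun x => ?_)
    simp only [((hφ.differentiable (by simp)) x).lineDeriv_eq_fderiv, map_neg]
    ring
-- Coordinate derivatives, classical and weak
/-- The first partial derivative of `φ` in the coordinate `i`. -/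
noncomputable def coordDeriv {d : ℕ} (i : Fin d) (φ : EuclideanSpace ℝ (Fin d) → ℝ)
    (x : EuclideanSpace ℝ (Fin d)) : ℝ :=
  fderiv ℝ φ x (EuclideanSpace.single i 1)

theorem ContDiff.coordDeriv {d : ℕ} {φ : EuclideanSpace ℝ (Fin d) → ℝ} (hφ : ContDiff ℝ ∞ φ)
    (i : Fin d) : ContDiff ℝ ∞ (coordDeriv i φ) :=
  (hφ.fderiv_right (m := ∞) (by simp)).clm_apply contDiff_const

theorem tsupport_coordDeriv_subset {d : ℕ} (i : Fin d) (φ : EuclideanSpace ℝ (Fin d) → ℝ) :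
    tsupport (coordDeriv i φ) ⊆ tsupport φ := by
  refine closure_minimal (fun x hx => ?_) (isClosed_tsupport φ)
  by_contra h
  refine hx ?_
  have : fderiv ℝ φ x = 0 :=
    image_eq_zero_of_notMem_tsupport fun h' => h (tsupport_fderiv_subset ℝ h')
  simp [coordDeriv, this]

theorem HasCompactSupport.coordDeriv {d : ℕ} {φ : EuclideanSpace ℝ (Fin d) → ℝ}
    (hφ : HasCompactSupport φ) (i : Fin d) : HasCompactSupport (coordDeriv i φ) :=
  hφ.of_isClosed_subset (isClosed_tsupport _) (tsupport_coordDeriv_subset i φ)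

theorem fderiv_apply_eq_sum_coordDeriv {d : ℕ} (w : EuclideanSpace ℝ (Fin d) → ℝ)
    (z h : EuclideanSpace ℝ (Fin d)) : fderiv ℝ w z h = ∑ b, h b * coordDeriv b w z := by
  conv_lhs => rw [← (EuclideanSpace.basisFun (Fin d) ℝ).sum_repr h]
  simp [coordDeriv]

/-- Appending at the end makes the new derivative act first, so that `coordDeriv c φ` can serve as a
test function for the weak derivative indexed by `i`. -/
theorem partialDeriv_snoc {d n : ℕ} (i : Fin n → Fin d) (c : Fin d)
    {φ : EuclideanSpace ℝ (Fin d) → ℝ} (hφ : ContDiff ℝ ∞ φ) :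
    partialDeriv (Fin.snoc i c : Fin (n + 1) → Fin d) φ = partialDeriv i (coordDeriv c φ) := by
  ext x
  have hd : ContDiff ℝ ∞ (fderiv ℝ φ) := hφ.fderiv_right (m := ∞) (by simp)
  have h := (ContinuousLinearMap.apply ℝ ℝ (EuclideanSpace.single c (1 : ℝ))).iteratedFDeriv_comp_left
    (x := x) (i := n) hd.contDiffAt (by exact_mod_cast le_top)
  have h2 : (ContinuousLinearMap.apply ℝ ℝ (EuclideanSpace.single c (1 : ℝ))) ∘ fderiv ℝ φ
      = coordDeriv c φ := rfl
  rw [h2] at h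
  rw [partialDeriv, partialDeriv, iteratedFDeriv_succ_apply_right, h]
  simp only [ContinuousLinearMap.compContinuousMultilinearMap_coe, Function.comp,
    ContinuousLinearMap.apply_apply, Fin.snoc_last]
  congr 2
  ext k
  simp [Fin.init]

/-- `g` is the weak derivative of `f` on `U` in the direction of the coordinate `c`, for functions
defined on the whole space. -/
def HasWeakCoordDeriv {d : ℕ} (U : Set (EuclideanSpace ℝ (Fin d))) (c : Fin d)
    (f g : EuclideanSpace ℝ (Fin d) → ℝ) : Prop :=
  ∀ φ : EuclideanSpace ℝ (Fin d) → ℝ, ContDiff ℝ ∞ φ → HasCompactSupport φ → tsupport φ ⊆ U →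
    ∫ x, f x * coordDeriv c φ x = -∫ x, g x * φ x

/-- The weak derivatives of each order are given separately; testing with `∂_c φ` shows that each is
a weak first derivative of the one of lower order. Extension by zero and measurable representatives
make them suitable for convolution on the whole space and for Tonelli. -/
theorem MemSobolev.exists_hasWeakCoordDeriv {d : ℕ} {U : Set (EuclideanSpace ℝ (Fin d))}
    (hU : MeasurableSet U) {f : EuclideanSpace ℝ (Fin d) → ℝ}
    (hf : MemSobolev 3 2 U f) :
    ∃ (g₁ : Fin d → EuclideanSpace ℝ (Fin d) → ℝ)
      (g₂ : Fin d → Fin d → EuclideanSpace ℝ (Fin d) → ℝ)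
      (g₃ : Fin d → Fin d → Fin d → EuclideanSpace ℝ (Fin d) → ℝ),
      (∀ a, Measurable (g₁ a) ∧ MemLp (g₁ a) 2 ∧ HasWeakCoordDeriv U a (U.indicator f) (g₁ a)) ∧
      (∀ a b, Measurable (g₂ a b) ∧ MemLp (g₂ a b) 2 ∧
        HasWeakCoordDeriv U b (g₁ a) (g₂ a b)) ∧
      ∀ a b c, Measurable (g₃ a b c) ∧ MemLp (g₃ a b c) 2 ∧
        HasWeakCoordDeriv U c (g₂ a b) (g₃ a b c) := by
  have hex : ∀ n ≤ 3, ∀ i : Fin n → Fin d, ∃ g : EuclideanSpace ℝ (Fin d) → ℝ,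
      Measurable g ∧ MemLp g 2 ∧ ∀ φ : EuclideanSpace ℝ (Fin d) → ℝ, ContDiff ℝ ∞ φ →
        HasCompactSupport φ → tsupport φ ⊆ U →
        ∫ x, U.indicator f x * partialDeriv i φ x = (-1) ^ n * ∫ x, g x * φ x := by
    intro n hn i
    obtain ⟨g, hg, hw⟩ := hf.2 n hn i
    have hgi : MemLp (U.indicator g) 2 := (memLp_indicator_iff_restrict hU).2 hg
    refine ⟨hgi.1.mk _, hgi.1.stronglyMeasurable_mk.measurable, hgi.ae_eq hgi.1.ae_eq_mk,
      fun φ h1 h2 h3 => ?_⟩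
    have e1 : ∫ x, hgi.1.mk _ x * φ x = ∫ x, U.indicator g x * φ x := by
      refine integral_congr_ae ?_
      filter_upwards [hgi.1.ae_eq_mk] with x hx
      rw [hx]
    rw [e1]
    have := hw.integral_eq φ h1 h2 h3
    rw [← integral_indicator hU, ← integral_indicator hU] at this
    simpa only [indicator_mul_left] using this
  choose! G hG using hex
  have step : ∀ n, n + 1 ≤ 3 → ∀ (i : Fin n → Fin d) (c : Fin d) (g : EuclideanSpace ℝ (Fin d) → ℝ),
      (∀ φ : EuclideanSpace ℝ (Fin d) → ℝ, ContDiff ℝ ∞ φ →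
        HasCompactSupport φ → tsupport φ ⊆ U →
        ∫ x, U.indicator f x * partialDeriv i φ x = (-1) ^ n * ∫ x, g x * φ x) →
      HasWeakCoordDeriv U c g (G (n + 1) (Fin.snoc i c)) := by
    intro n hn i c g hg φ h1 h2 h3
    have e1 := (hG (n + 1) hn (Fin.snoc i c)).2.2 φ h1 h2 h3
    have e2 := hg (coordDeriv c φ) (h1.coordDeriv c) (h2.coordDeriv c)
      ((tsupport_coordDeriv_subset c φ).trans h3)
    rw [partialDeriv_snoc i c h1, e2, pow_succ, mul_assoc] at e1
    have := mul_left_cancel₀ (pow_ne_zero n (by norm_num : (-1 : ℝ) ≠ 0)) e1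
    simpa using this
  let i₁ : Fin d → Fin 1 → Fin d := fun a => Fin.snoc (Fin.elim0 : Fin 0 → Fin d) a
  let i₂ : Fin d → Fin d → Fin 2 → Fin d := fun a b => Fin.snoc (i₁ a) b
  let i₃ : Fin d → Fin d → Fin d → Fin 3 → Fin d := fun a b c => Fin.snoc (i₂ a b) c
  refine ⟨fun a => G 1 (i₁ a), fun a b => G 2 (i₂ a b), fun a b c => G 3 (i₃ a b c),
    fun a => ?_, fun a b => ?_, fun a b c => ?_⟩
  · have h := hG 1 (by norm_num) (i₁ a)
    exact ⟨h.1, h.2.1, step 0 (by norm_num) _ a _ fun φ _ _ _ => by simp [partialDeriv_zero]⟩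
  · have h := hG 2 (by norm_num) (i₂ a b)
    exact ⟨h.1, h.2.1, step 1 (by norm_num) (i₁ a) b _ (hG 1 (by norm_num) (i₁ a)).2.2⟩
  · have h := hG 3 (by norm_num) (i₃ a b c)
    exact ⟨h.1, h.2.1, step 2 (by norm_num) (i₂ a b) c _ (hG 2 (by norm_num) (i₂ a b)).2.2⟩

/-! ### Mollification -/

/-- The convolution `f * φ` on `ℝ^d`, with the regular factor last. -/
noncomputable def mollify {d : ℕ} (φ f : EuclideanSpace ℝ (Fin d) → ℝ) :
    EuclideanSpace ℝ (Fin d) → ℝ :=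
  convolution f φ (ContinuousLinearMap.mul ℝ ℝ) volume

theorem mollify_apply {d : ℕ} (φ f : EuclideanSpace ℝ (Fin d) → ℝ)
    (x : EuclideanSpace ℝ (Fin d)) : mollify φ f x = ∫ t, f t * φ (x - t) := rfl

theorem mollify_apply_swap {d : ℕ} (φ f : EuclideanSpace ℝ (Fin d) → ℝ)
    (x : EuclideanSpace ℝ (Fin d)) : mollify φ f x = ∫ t, f (x - t) * φ t :=
  convolution_mul_swap

theorem contDiff_mollify {d : ℕ} {φ f : EuclideanSpace ℝ (Fin d) → ℝ} (hφ : ContDiff ℝ ∞ φ)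
    (hc : HasCompactSupport φ) (hf : LocallyIntegrable f) : ContDiff ℝ ∞ (mollify φ f) :=
  hc.contDiff_convolution_right _ hf hφ

theorem coordDeriv_mollify {d : ℕ} {φ f : EuclideanSpace ℝ (Fin d) → ℝ} (hφ : ContDiff ℝ ∞ φ)
    (hc : HasCompactSupport φ) (hf : LocallyIntegrable f) (i : Fin d) :
    coordDeriv i (mollify φ f) = mollify (coordDeriv i φ) f := by
  ext x
  have h1 : ContDiff ℝ 1 φ := hφ.of_le (by exact_mod_cast le_top)
  have h := hc.hasFDerivAt_convolution_right (ContinuousLinearMap.mul ℝ ℝ) hf h1 x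
  rw [coordDeriv, mollify, h.fderiv,
    convolution_precompR_apply _ hf (hc.fderiv ℝ) (h1.continuous_fderiv one_ne_zero)]
  rfl

/-- The function `y ↦ φ (x - y)` is an admissible test function, its support lying in the ball
around `x`; the sign from the reflection cancels the sign in the weak derivative. -/
theorem HasWeakCoordDeriv.mollify_coordDeriv {d : ℕ} {U : Set (EuclideanSpace ℝ (Fin d))}
    {i : Fin d} {f g φ : EuclideanSpace ℝ (Fin d) → ℝ} (h : HasWeakCoordDeriv U i f g)
    (hφ : ContDiff ℝ ∞ φ) {ε : ℝ} (hε : tsupport φ ⊆ Metric.closedBall 0 ε)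
    {x : EuclideanSpace ℝ (Fin d)} (hx : Metric.closedBall x ε ⊆ U) :
    mollify (coordDeriv i φ) f x = mollify φ g x := by
  have hs : tsupport (fun y => φ (x - y)) ⊆ Metric.closedBall x ε := by
    refine closure_minimal (fun y hy => ?_) Metric.isClosed_closedBall
    have := hε (subset_tsupport φ hy)
    rwa [mem_closedBall_zero_iff, ← dist_eq_norm, dist_comm] at this
  have := h (fun y => φ (x - y)) (hφ.comp (contDiff_const.sub contDiff_id))
    ((isCompact_closedBall x ε).of_isClosed_subset (isClosed_tsupport _) hs) (hs.trans hx)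
  have hd : ∀ y, coordDeriv i (fun y => φ (x - y)) y = -coordDeriv i φ (x - y) := by
    intro y
    have h1 : HasFDerivAt φ (fderiv ℝ φ (x - y)) (x - y) :=
      (hφ.differentiable (by simp) (x - y)).hasFDerivAt
    have h2 := h1.comp y ((hasFDerivAt_id y).const_sub x)
    have h3 : fderiv ℝ (fun y => φ (x - y)) y = _ := h2.fderiv
    rw [coordDeriv, h3]
    simp [coordDeriv]
  simp only [hd, mul_neg, integral_neg, neg_inj] at this
  simpa only [mollify_apply] using this
-- Taylor's formula along a segment
theorem hasDerivAt_comp_line {d : ℕ} {w : EuclideanSpace ℝ (Fin d) → ℝ}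
    (hw : ContDiff ℝ ∞ w) (x h : EuclideanSpace ℝ (Fin d)) (s : ℝ) :
    HasDerivAt (fun s : ℝ => w (x + s • h)) (∑ b, h b * coordDeriv b w (x + s • h)) s := by
  have h1 : HasFDerivAt w (fderiv ℝ w (x + s • h)) (x + s • h) :=
    (hw.differentiable (by simp) _).hasFDerivAt
  have h2 : HasDerivAt (fun s : ℝ => x + s • h) h s := by
    simpa using ((hasDerivAt_id s).smul_const h).const_add x
  rw [← fderiv_apply_eq_sum_coordDeriv]
  exact h1.comp_hasDerivAt s h2

theorem enorm_sum_mul_le {d : ℕ} {h v : Fin d → ℝ} {R : ℝ≥0∞} (hR : ∀ b, ‖h b‖ₑ ≤ R) :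
    ‖∑ b, h b * v b‖ₑ ≤ R * ∑ b, ‖v b‖ₑ := by
  refine (enorm_sum_le _ _).trans ?_
  rw [Finset.mul_sum]
  refine Finset.sum_le_sum fun b _ => ?_
  rw [enorm_mul]
  gcongr
  exact hR b

/-- Second order Taylor estimate along a segment, expanded at its endpoint `y`. -/
theorem enorm_le_taylor_two {d : ℕ} {w : EuclideanSpace ℝ (Fin d) → ℝ}
    (hw : ContDiff ℝ ∞ w) (x y : EuclideanSpace ℝ (Fin d)) {R : ℝ≥0∞}
    (hR : ∀ b, ‖(y - x) b‖ₑ ≤ R) :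
    ‖w x‖ₑ ≤ ‖w y‖ₑ + R * ∑ b, ‖coordDeriv b w y‖ₑ +
      ∫⁻ s in Ioc (0 : ℝ) 1, ENNReal.ofReal s *
        (R * ∑ b, R * ∑ c, ‖coordDeriv c (coordDeriv b w) (x + s • (y - x))‖ₑ) := by
  set h := y - x with hh
  set g₁ : ℝ → ℝ := fun s => ∑ b, h b * coordDeriv b w (x + s • h)
  set g₂ : ℝ → ℝ := fun s => ∑ b, h b * ∑ c, h c * coordDeriv c (coordDeriv b w) (x + s • h)
  have hd1 : ∀ s, HasDerivAt g₁ (g₂ s) s := fun s =>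
    HasDerivAt.fun_sum fun b _ => (hasDerivAt_comp_line (hw.coordDeriv b) x h s).const_mul _
  have hc2 : Continuous g₂ := by
    refine continuous_finsetSum _ fun b _ => continuous_const.mul <|
      continuous_finsetSum _ fun c _ => continuous_const.mul ?_
    exact ((hw.coordDeriv b).coordDeriv c).continuous.comp (by fun_prop)
  -- This primitive yields the remainder with weight `s`. The weight vanishes at the end `x`,
  -- exactly where averaging over `y` will produce the singular factor `s^(-d/2)`.
  have hd : ∀ s ∈ uIcc (0 : ℝ) 1, HasDerivAt (fun s => s * g₁ s - w (x + s • h)) (s * g₂ s) s := by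
    intro s _
    have := ((hasDerivAt_id s).mul (hd1 s)).sub (hasDerivAt_comp_line hw x h s)
    refine this.congr_deriv ?_
    simp only [g₁, id]
    ring
  have hint := intervalIntegral.integral_eq_sub_of_hasDerivAt hd
    ((continuous_id.mul hc2).intervalIntegrable 0 1)
  have hxy : x + h = y := by simp [hh]
  simp only [one_mul, one_smul, hxy, zero_mul, zero_smul, add_zero] at hint
  have hg1 : g₁ 1 = ∑ b, h b * coordDeriv b w y := by simp [g₁, hxy]
  have e : w x = w y - g₁ 1 + ∫ s in (0 : ℝ)..1, s * g₂ s := by rw [hint]; ring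
  rw [e]
  refine (enorm_add_le _ _).trans (add_le_add ((enorm_sub_le).trans ?_) ?_)
  · rw [hg1]
    gcongr
    exact enorm_sum_mul_le hR
  · rw [intervalIntegral.integral_of_le zero_le_one]
    refine (enorm_integral_le_lintegral_enorm _).trans (setLIntegral_mono' measurableSet_Ioc ?_)
    intro s hs
    rw [enorm_mul, Real.enorm_of_nonneg hs.1.le]
    gcongr
    refine (enorm_sum_mul_le hR).trans ?_
    gcongr
    exact enorm_sum_mul_le hR

/-! ### Dilation estimates in `L²` -/

/-- Translations preserve the norm, and the dilation has inverse Jacobian `s^(-d)`, whose square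
root enters the `L²` norm. -/
theorem eLpNorm_comp_add_smul {d : ℕ} {g : EuclideanSpace ℝ (Fin d) → ℝ} (hg : Measurable g)
    (z : EuclideanSpace ℝ (Fin d)) {s : ℝ} (hs : 0 < s) :
    eLpNorm (fun y => g (z + s • y)) 2 volume =
      ENNReal.ofReal (s ^ (-(d : ℝ) / 2)) * eLpNorm g 2 volume := by
  have hm : Measurable fun y => g (z + y) := hg.comp (measurable_const_add z)
  have h1 := eLpNorm_map_measure (μ := (volume : Measure (EuclideanSpace ℝ (Fin d)))) (p := 2)
    (f := fun y => s • y) (g := fun y => g (z + y))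
    hm.aestronglyMeasurable (measurable_const_smul s).aemeasurable
  rw [Measure.map_addHaar_smul _ hs.ne'] at h1
  have h2 : eLpNorm (fun y => g (z + y)) 2 volume = eLpNorm g 2 volume :=
    eLpNorm_comp_measurePreserving (g := g) hg.aestronglyMeasurable
      (measurePreserving_add_left volume z)
  have h3 : ((fun y => g (z + y)) ∘ fun y => s • y) = fun y => g (z + s • y) := rfl
  rw [h3] at h1
  rw [← h1, eLpNorm_smul_measure_of_ne_top (by norm_num), h2, smul_eq_mul]
  congr 1
  rw [ENNReal.ofReal_rpow_of_nonneg (abs_nonneg _) (by simp)]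
  congr 1
  rw [abs_of_pos (by positivity), finrank_euclideanSpace_fin, ← Real.rpow_natCast,
    ← Real.rpow_neg hs.le, ← Real.rpow_mul hs.le]
  congr 1
  simp
  ring

theorem setLIntegral_enorm_comp_add_smul_le {d : ℕ} {g : EuclideanSpace ℝ (Fin d) → ℝ}
    (hg : Measurable g) (z : EuclideanSpace ℝ (Fin d)) {s : ℝ} (hs : 0 < s)
    (B : Set (EuclideanSpace ℝ (Fin d))) :
    ∫⁻ y in B, ‖g (z + s • y)‖ₑ ≤
      ENNReal.ofReal (s ^ (-(d : ℝ) / 2)) * (eLpNorm g 2 volume * volume B ^ (1 / 2 : ℝ)) := by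
  have hm : Measurable fun y => g (z + s • y) := hg.comp (by fun_prop)
  have h := eLpNorm_le_eLpNorm_mul_rpow_measure_univ (μ := volume.restrict B) (p := 1) (q := 2)
    (f := fun y => g (z + s • y)) (by norm_num) hm.aestronglyMeasurable
  rw [eLpNorm_one_eq_lintegral_enorm, Measure.restrict_apply_univ] at h
  refine h.trans ?_
  rw [← mul_assoc, ← eLpNorm_comp_add_smul hg z hs]
  have he : (1 / (1 : ℝ≥0∞).toReal - 1 / (2 : ℝ≥0∞).toReal) = (1 / 2 : ℝ) := by norm_num
  rw [he]
  gcongr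
  exact Measure.restrict_le_self

/-- By Tonelli, the mollification is an average of translates of `g` with weights of total mass one.
The dilation bound does not depend on the translation, so it survives without any dependence on `φ`.
-/
theorem setLIntegral_enorm_mollify_le {d : ℕ} {φ g : EuclideanSpace ℝ (Fin d) → ℝ}
    (hφ : Continuous φ) (hφ1 : ∫⁻ t, ‖φ t‖ₑ = 1) (hg : Measurable g)
    (x : EuclideanSpace ℝ (Fin d)) {s : ℝ} (hs : 0 < s) (B : Set (EuclideanSpace ℝ (Fin d))) :
    ∫⁻ y in B, ‖mollify φ g (x + s • (y - x))‖ₑ ≤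
      ENNReal.ofReal (s ^ (-(d : ℝ) / 2)) * (eLpNorm g 2 volume * volume B ^ (1 / 2 : ℝ)) := by
  calc ∫⁻ y in B, ‖mollify φ g (x + s • (y - x))‖ₑ
      ≤ ∫⁻ y in B, ∫⁻ t, ‖g (x + s • (y - x) - t)‖ₑ * ‖φ t‖ₑ := by
        refine lintegral_mono fun y => ?_
        rw [mollify_apply_swap]
        refine (enorm_integral_le_lintegral_enorm _).trans_eq ?_
        simp only [enorm_mul]
    _ = ∫⁻ t, ∫⁻ y in B, ‖g (x + s • (y - x) - t)‖ₑ * ‖φ t‖ₑ := by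
        refine lintegral_lintegral_swap (Measurable.aemeasurable ?_)
        refine Measurable.mul (hg.comp ?_).enorm (hφ.measurable.comp measurable_snd).enorm
        fun_prop
    _ ≤ ∫⁻ t, ENNReal.ofReal (s ^ (-(d : ℝ) / 2)) *
          (eLpNorm g 2 volume * volume B ^ (1 / 2 : ℝ)) * ‖φ t‖ₑ := by
        refine lintegral_mono fun t => ?_
        rw [lintegral_mul_const' _ _ enorm_ne_top]
        gcongr
        refine le_trans (le_of_eq ?_) (setLIntegral_enorm_comp_add_smul_le hg (x - s • x - t) hs B)
        refine lintegral_congr fun y => ?_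
        congr 2
        rw [smul_sub]
        abel
    _ = _ := by
        rw [lintegral_const_mul _ hφ.measurable.enorm, hφ1, mul_one]

/-- The exponent `1 - d/2` exceeds `-1` exactly when `d < 4`; this is where the dimension bound
enters. -/
theorem lintegral_ofReal_mul_rpow_lt_top {d : ℕ} (hd : d ≤ 3) :
    ∫⁻ s in Ioc (0 : ℝ) 1, ENNReal.ofReal s * ENNReal.ofReal (s ^ (-(d : ℝ) / 2)) < ⊤ := by
  have hd' : (d : ℝ) ≤ 3 := by exact_mod_cast hd
  have hi : IntegrableOn (fun s : ℝ => s ^ (1 - (d : ℝ) / 2)) (Ioc 0 1) :=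
    (intervalIntegrable_iff_integrableOn_Ioc_of_le zero_le_one).1
      (intervalIntegral.intervalIntegrable_rpow' (by linarith))
  refine lt_of_le_of_lt (le_of_eq ?_) hi.lintegral_lt_top
  refine setLIntegral_congr_fun measurableSet_Ioc fun s hs => ?_
  rw [← ENNReal.ofReal_mul hs.1.le]
  congr 1
  rw [sub_eq_add_neg, Real.rpow_add hs.1, Real.rpow_one, neg_div]
-- Uniform gradient bound for mollifications
theorem IsOpen.eventually_closedBall_subset {E : Type*} [NormedAddCommGroup E] [ProperSpace E]
    {U : Set E} (hU : IsOpen U) {x : E} {ε : ℝ} (hx : Metric.closedBall x ε ⊆ U) :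
    ∀ᶠ z in nhds x, Metric.closedBall z ε ⊆ U := by
  obtain ⟨δ, hδ, hδU⟩ := (isCompact_closedBall x ε).exists_thickening_subset_open hU hx
  filter_upwards [Metric.ball_mem_nhds x hδ] with z hz y hy
  refine hδU (Metric.mem_thickening_iff.2 ⟨y - z + x, ?_, ?_⟩)
  · rwa [Metric.mem_closedBall, dist_eq_norm, add_sub_cancel_right, ← dist_eq_norm]
  · rw [Metric.mem_ball, dist_eq_norm] at hz
    rw [dist_eq_norm]
    convert hz using 2
    abel

/-- The points whose closed `ε`-ball lies in `U` form an open set, so an identity valid there may be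
differentiated. Stating it for any `w` agreeing there with a mollification lets it be iterated
through all three orders. -/
theorem HasWeakCoordDeriv.coordDeriv_eq_mollify {d : ℕ} {U : Set (EuclideanSpace ℝ (Fin d))}
    (hU : IsOpen U) {i : Fin d} {f g φ w : EuclideanSpace ℝ (Fin d) → ℝ}
    (h : HasWeakCoordDeriv U i f g) (hf : LocallyIntegrable f) (hφ : ContDiff ℝ ∞ φ)
    (hc : HasCompactSupport φ) {ε : ℝ} (hε : tsupport φ ⊆ Metric.closedBall 0 ε)
    (hw : ∀ z, Metric.closedBall z ε ⊆ U → w z = mollify φ f z)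
    {z : EuclideanSpace ℝ (Fin d)} (hz : Metric.closedBall z ε ⊆ U) :
    coordDeriv i w z = mollify φ g z := by
  have he : w =ᶠ[nhds z] mollify φ f := (hU.eventually_closedBall_subset hz).mono hw
  rw [coordDeriv, he.fderiv_eq, ← coordDeriv, coordDeriv_mollify hφ hc hf,
    h.mollify_coordDeriv hφ hε hz]

theorem lintegral_mul_sum_mul_sum {α ι : Type*} [MeasurableSpace α] [Fintype ι] (μ : Measure α)
    {F : ι → ι → α → ℝ≥0∞} (hF : ∀ b c, Measurable (F b c)) (k R : ℝ≥0∞) :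
    ∫⁻ y, k * (R * ∑ b, R * ∑ c, F b c y) ∂μ = k * (R * ∑ b, R * ∑ c, ∫⁻ y, F b c y ∂μ) := by
  have h₁ : ∀ b, Measurable fun y => ∑ c, F b c y := fun b =>
    Finset.measurable_fun_sum _ fun c _ => hF b c
  have h₂ : Measurable fun y => ∑ b, R * ∑ c, F b c y :=
    Finset.measurable_fun_sum _ fun b _ => (h₁ b).const_mul R
  rw [lintegral_const_mul _ (h₂.const_mul R), lintegral_const_mul _ h₂,
    lintegral_finsetSum _ fun b _ => (h₁ b).const_mul R]
  congr 2
  refine Finset.sum_congr rfl fun b _ => ?_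
  rw [lintegral_const_mul _ (h₁ b), lintegral_finsetSum _ fun c _ => hF b c]

/-- The second order Taylor estimate averaged over the endpoint `y ∈ B`. -/
theorem enorm_mul_volume_le_taylor_two {d : ℕ} {w : EuclideanSpace ℝ (Fin d) → ℝ}
    (hws : ContDiff ℝ ∞ w) (x : EuclideanSpace ℝ (Fin d)) {R : ℝ≥0∞}
    {B : Set (EuclideanSpace ℝ (Fin d))} (hBm : MeasurableSet B)
    (hR : ∀ y ∈ B, ∀ b, ‖(y - x) b‖ₑ ≤ R) :
    ‖w x‖ₑ * volume B ≤
      (∫⁻ y in B, ‖w y‖ₑ) + R * ∑ b, (∫⁻ y in B, ‖coordDeriv b w y‖ₑ) +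
        ∫⁻ s in Ioc (0 : ℝ) 1, ENNReal.ofReal s *
          (R * ∑ b, R * ∑ c, ∫⁻ y in B,
            ‖coordDeriv c (coordDeriv b w) (x + s • (y - x))‖ₑ) := by
  have hmc : ∀ b c, Measurable fun p : EuclideanSpace ℝ (Fin d) × ℝ =>
      ‖coordDeriv c (coordDeriv b w) (x + p.2 • (p.1 - x))‖ₑ := by
    intro b c
    have hcont : Continuous fun p : EuclideanSpace ℝ (Fin d) × ℝ => x + p.2 • (p.1 - x) := by
      fun_prop
    exact (((hws.coordDeriv b).coordDeriv c).continuous.comp hcont).measurable.enorm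
  have hmc' : ∀ b, Measurable fun p : EuclideanSpace ℝ (Fin d) × ℝ =>
      R * ∑ c, ‖coordDeriv c (coordDeriv b w) (x + p.2 • (p.1 - x))‖ₑ := fun b =>
    (Finset.measurable_fun_sum _ fun c _ => hmc b c).const_mul R
  have hmF : Measurable fun p : EuclideanSpace ℝ (Fin d) × ℝ => ENNReal.ofReal p.2 *
      (R * ∑ b, R * ∑ c, ‖coordDeriv c (coordDeriv b w) (x + p.2 • (p.1 - x))‖ₑ) :=
    (ENNReal.measurable_ofReal.comp measurable_snd).mul
      ((Finset.measurable_fun_sum _ fun b _ => hmc' b).const_mul R)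
  calc ‖w x‖ₑ * volume B = ∫⁻ _ in B, ‖w x‖ₑ := by rw [setLIntegral_const]
    _ ≤ ∫⁻ y in B, (‖w y‖ₑ + R * ∑ b, ‖coordDeriv b w y‖ₑ +
          ∫⁻ s in Ioc (0 : ℝ) 1, ENNReal.ofReal s *
            (R * ∑ b, R * ∑ c, ‖coordDeriv c (coordDeriv b w) (x + s • (y - x))‖ₑ)) :=
        setLIntegral_mono' hBm fun y hy => enorm_le_taylor_two hws x y (hR y hy)
    _ = (∫⁻ y in B, ‖w y‖ₑ) + R * ∑ b, (∫⁻ y in B, ‖coordDeriv b w y‖ₑ) +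
          ∫⁻ s in Ioc (0 : ℝ) 1, ENNReal.ofReal s *
            (R * ∑ b, R * ∑ c, ∫⁻ y in B,
              ‖coordDeriv c (coordDeriv b w) (x + s • (y - x))‖ₑ) := by
        have m1 : Measurable fun y => ‖w y‖ₑ := hws.continuous.measurable.enorm
        have m2 : ∀ b, Measurable fun y => ‖coordDeriv b w y‖ₑ := fun b =>
          (hws.coordDeriv b).continuous.measurable.enorm
        have m2s : Measurable fun y => ∑ b, ‖coordDeriv b w y‖ₑ :=
          Finset.measurable_fun_sum _ fun b _ => m2 b
        have m12 : Measurable fun y => ‖w y‖ₑ + R * ∑ b, ‖coordDeriv b w y‖ₑ :=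
          m1.add (m2s.const_mul R)
        rw [lintegral_add_left m12, lintegral_add_left m1,
          lintegral_const_mul _ m2s, lintegral_finsetSum _ fun b _ => m2 b,
          lintegral_lintegral_swap hmF.aemeasurable]
        congr 1
        refine lintegral_congr fun s => ?_
        have hcont : Continuous fun y : EuclideanSpace ℝ (Fin d) => x + s • (y - x) := by
          fun_prop
        have m3 : ∀ b c, Measurable fun y : EuclideanSpace ℝ (Fin d) =>
            ‖coordDeriv c (coordDeriv b w) (x + s • (y - x))‖ₑ := fun b c =>
          (((hws.coordDeriv b).coordDeriv c).continuous.comp hcont).measurable.enorm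
        exact lintegral_mul_sum_mul_sum _ m3 _ _

/-- A uniform bound on the gradient of the mollification of a function with weak derivatives up to
order three in `L²`, on the points that stay at distance `ε` from the complement of `U`. -/
theorem enorm_coordDeriv_mollify_mul_le {d : ℕ} {U : Set (EuclideanSpace ℝ (Fin d))}
    (hUo : IsOpen U) (hU : Convex ℝ U) {R : ℝ≥0∞} (hR : ∀ x ∈ U, ∀ y ∈ U, edist x y ≤ R)
    {f : EuclideanSpace ℝ (Fin d) → ℝ} (hf : LocallyIntegrable f) {a : Fin d}
    {g₁ : EuclideanSpace ℝ (Fin d) → ℝ} {g₂ : Fin d → EuclideanSpace ℝ (Fin d) → ℝ}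
    {g₃ : Fin d → Fin d → EuclideanSpace ℝ (Fin d) → ℝ}
    (hm₁ : Measurable g₁) (hm₂ : ∀ b, Measurable (g₂ b)) (hm₃ : ∀ b c, Measurable (g₃ b c))
    (hi₁ : LocallyIntegrable g₁) (hi₂ : ∀ b, LocallyIntegrable (g₂ b))
    (hg₁ : HasWeakCoordDeriv U a f g₁) (hg₂ : ∀ b, HasWeakCoordDeriv U b g₁ (g₂ b))
    (hg₃ : ∀ b c, HasWeakCoordDeriv U c (g₂ b) (g₃ b c))
    {φ : EuclideanSpace ℝ (Fin d) → ℝ} (hφ : ContDiff ℝ ∞ φ) {ε : ℝ} (hε0 : 0 ≤ ε)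
    (hε : tsupport φ ⊆ Metric.closedBall 0 ε) (hφ1 : ∫⁻ t, ‖φ t‖ₑ = 1)
    {B : Set (EuclideanSpace ℝ (Fin d))} (hBm : MeasurableSet B)
    (hB : ∀ y ∈ B, Metric.closedBall y ε ⊆ U)
    {x : EuclideanSpace ℝ (Fin d)} (hx : Metric.closedBall x ε ⊆ U) :
    ‖coordDeriv a (mollify φ f) x‖ₑ * volume B ≤
      (eLpNorm g₁ 2 volume + R * ∑ b, eLpNorm (g₂ b) 2 volume +
        (∫⁻ s in Ioc (0 : ℝ) 1, ENNReal.ofReal s * ENNReal.ofReal (s ^ (-(d : ℝ) / 2))) *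
          (R * ∑ b, R * ∑ c, eLpNorm (g₃ b c) 2 volume)) * volume B ^ (1 / 2 : ℝ) := by
  have hc : HasCompactSupport φ :=
    (isCompact_closedBall _ _).of_isClosed_subset (isClosed_tsupport _) hε
  set w := coordDeriv a (mollify φ f) with hw
  have hws : ContDiff ℝ ∞ w := (contDiff_mollify hφ hc hf).coordDeriv a
  have d1 : ∀ z, Metric.closedBall z ε ⊆ U → w z = mollify φ g₁ z := fun z hz =>
    hg₁.coordDeriv_eq_mollify hUo hf hφ hc hε (fun _ _ => rfl) hz
  have d2 : ∀ b z, Metric.closedBall z ε ⊆ U → coordDeriv b w z = mollify φ (g₂ b) z :=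
    fun b z hz => (hg₂ b).coordDeriv_eq_mollify hUo hi₁ hφ hc hε d1 hz
  have d3 : ∀ b c z, Metric.closedBall z ε ⊆ U →
      coordDeriv c (coordDeriv b w) z = mollify φ (g₃ b c) z := fun b c z hz =>
    (hg₃ b c).coordDeriv_eq_mollify hUo (hi₂ b) hφ hc hε (d2 b) hz
  have hxU : x ∈ U := hx (Metric.mem_closedBall_self hε0)
  -- Shifting both endpoints by the same vector `p` of length at most `ε` stays in `U`, and
  -- convexity of `U` then covers the shifted segment.
  have hseg : ∀ y ∈ B, ∀ s ∈ Ioc (0 : ℝ) 1, Metric.closedBall (x + s • (y - x)) ε ⊆ U := by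
    intro y hy s hs z hz
    set p := z - (x + s • (y - x)) with hp
    have hpε : ‖p‖ ≤ ε := by rwa [hp, ← dist_eq_norm]
    have h1 : x + p ∈ U := hx (by simpa using hpε)
    have h2 : y + p ∈ U := hB y hy (by simpa using hpε)
    have h3 := hU.add_smul_sub_mem h1 h2 ⟨hs.1.le, hs.2⟩
    convert h3 using 1
    rw [add_sub_add_right_eq_sub, hp]
    abel
  have hcoord : ∀ y ∈ B, ∀ b, ‖(y - x) b‖ₑ ≤ R := by
    intro y hy b
    have hyU : y ∈ U := hB y hy (Metric.mem_closedBall_self hε0)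
    refine le_trans ?_ (hR y hyU x hxU)
    rw [edist_eq_enorm_sub]
    exact enorm_le_iff_norm_le.2 (PiLp.norm_apply_le _ _)
  set N := volume B ^ (1 / 2 : ℝ)
  -- The terms without dilation are the case `s = 1`.
  have one_s : ∀ g, Measurable g → ∫⁻ y in B, ‖mollify φ g y‖ₑ ≤ eLpNorm g 2 volume * N := by
    intro g hg
    simpa [N] using setLIntegral_enorm_mollify_le hφ.continuous hφ1 hg x one_pos B
  calc ‖w x‖ₑ * volume B ≤ (∫⁻ y in B, ‖w y‖ₑ) + R * ∑ b, (∫⁻ y in B, ‖coordDeriv b w y‖ₑ) +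
          ∫⁻ s in Ioc (0 : ℝ) 1, ENNReal.ofReal s *
            (R * ∑ b, R * ∑ c, ∫⁻ y in B,
              ‖coordDeriv c (coordDeriv b w) (x + s • (y - x))‖ₑ) :=
        enorm_mul_volume_le_taylor_two hws x hBm hcoord
    _ ≤ eLpNorm g₁ 2 volume * N + R * ∑ b, eLpNorm (g₂ b) 2 volume * N +
          ∫⁻ s in Ioc (0 : ℝ) 1, ENNReal.ofReal s *
            (R * ∑ b, R * ∑ c, ENNReal.ofReal (s ^ (-(d : ℝ) / 2)) *
              (eLpNorm (g₃ b c) 2 volume * N)) := by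
        refine add_le_add (add_le_add ?_ ?_) (setLIntegral_mono' measurableSet_Ioc fun s hs => ?_)
        · rw [setLIntegral_congr_fun hBm fun y hy => by rw [d1 y (hB y hy)]]
          exact one_s _ hm₁
        · gcongr with b
          rw [setLIntegral_congr_fun hBm fun y hy => by rw [d2 b y (hB y hy)]]
          exact one_s _ (hm₂ b)
        · gcongr with b _ c
          rw [setLIntegral_congr_fun hBm fun y hy => by rw [d3 b c _ (hseg y hy s hs)]]
          exact setLIntegral_enorm_mollify_le hφ.continuous hφ1 (hm₃ b c) x hs.1 B
    _ = _ := by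
        have e : ∀ s : ℝ, ENNReal.ofReal s *
            (R * ∑ b, R * ∑ c, ENNReal.ofReal (s ^ (-(d : ℝ) / 2)) *
              (eLpNorm (g₃ b c) 2 volume * N)) =
            ENNReal.ofReal s * ENNReal.ofReal (s ^ (-(d : ℝ) / 2)) *
              ((R * ∑ b, R * ∑ c, eLpNorm (g₃ b c) 2 volume) * N) := by
          intro s
          simp only [Finset.mul_sum, Finset.sum_mul]
          refine Finset.sum_congr rfl fun b _ => Finset.sum_congr rfl fun c _ => ?_
          ring
        simp only [e]
        rw [lintegral_mul_const _ (by fun_prop), ← Finset.sum_mul]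
        ring
-- From `H³` to Lipschitz on a convex set
theorem norm_fderiv_le_of_coordDeriv {d : ℕ} {w : EuclideanSpace ℝ (Fin d) → ℝ}
    {z : EuclideanSpace ℝ (Fin d)} {M : Fin d → ℝ} (hM : ∀ a, |coordDeriv a w z| ≤ M a) :
    ‖fderiv ℝ w z‖ ≤ ∑ a, M a := by
  have hM0 : ∀ a, 0 ≤ M a := fun a => (abs_nonneg _).trans (hM a)
  refine ContinuousLinearMap.opNorm_le_bound _ (Finset.sum_nonneg fun a _ => hM0 a) fun h => ?_
  rw [fderiv_apply_eq_sum_coordDeriv, Finset.sum_mul]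
  refine (norm_sum_le _ _).trans (Finset.sum_le_sum fun a _ => ?_)
  rw [norm_mul, mul_comm, Real.norm_eq_abs (coordDeriv a w z)]
  exact mul_le_mul (hM a) (PiLp.norm_apply_le h a) (norm_nonneg _) (hM0 a)

/-- On a bounded convex open set of dimension at most three, a continuous function in `H³` is
Lipschitz. -/
theorem MemSobolev.exists_lipschitzOnWith {d : ℕ} (hd : d ≤ 3)
    {U : Set (EuclideanSpace ℝ (Fin d))} (hUo : IsOpen U) (hU : Convex ℝ U)
    (hUb : Bornology.IsBounded U) (hUne : U.Nonempty)
    {f : EuclideanSpace ℝ (Fin d) → ℝ} (hf : MemSobolev 3 2 U f) (hfc : ContinuousOn f U) :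
    ∃ L : ℝ≥0, LipschitzOnWith L f U := by
  obtain ⟨g₁, g₂, g₃, h₁, h₂, h₃⟩ := hf.exists_hasWeakCoordDeriv hUo.measurableSet
  have hfm : MemLp (U.indicator f) 2 := (memLp_indicator_iff_restrict hUo.measurableSet).2 hf.1
  have hfl : LocallyIntegrable (U.indicator f) := hfm.locallyIntegrable (by norm_num)
  obtain ⟨x₀, hx₀⟩ := hUne
  obtain ⟨r, hr, hrU⟩ := Metric.isOpen_iff.1 hUo x₀ hx₀
  -- Half the radius leaves room for mollifiers supported within `r / 2`: their balls around points
  -- of `B` stay in `U`.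
  set B := Metric.ball x₀ (r / 2)
  have hB0 : volume B ≠ 0 := (Metric.measure_ball_pos volume x₀ (half_pos hr)).ne'
  have hBt : volume B ≠ ⊤ := measure_ball_lt_top.ne
  set R : ℝ≥0∞ := Metric.ediam U
  have hRt : R ≠ ⊤ := hUb.ediam_ne_top
  set I := ∫⁻ s in Ioc (0 : ℝ) 1, ENNReal.ofReal s * ENNReal.ofReal (s ^ (-(d : ℝ) / 2))
  have hI : I ≠ ⊤ := (lintegral_ofReal_mul_rpow_lt_top hd).ne
  let C : Fin d → ℝ≥0∞ := fun a =>
    (eLpNorm (g₁ a) 2 volume + R * ∑ b, eLpNorm (g₂ a b) 2 volume +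
      I * (R * ∑ b, R * ∑ c, eLpNorm (g₃ a b c) 2 volume)) * volume B ^ (1 / 2 : ℝ)
  have hC : ∀ a, C a ≠ ⊤ := by
    intro a
    have k₁ := (h₁ a).2.1.2.ne
    have k₂ := fun b => (h₂ a b).2.1.2.ne
    have k₃ := fun b c => (h₃ a b c).2.1.2.ne
    refine ENNReal.mul_ne_top (ENNReal.add_ne_top.2 ⟨ENNReal.add_ne_top.2 ⟨k₁, ?_⟩, ?_⟩)
      (ENNReal.rpow_ne_top_of_nonneg (by norm_num) hBt)
    · exact ENNReal.mul_ne_top hRt (ENNReal.sum_ne_top.2 fun b _ => k₂ b)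
    · exact ENNReal.mul_ne_top hI <| ENNReal.mul_ne_top hRt <| ENNReal.sum_ne_top.2 fun b _ =>
        ENNReal.mul_ne_top hRt <| ENNReal.sum_ne_top.2 fun c _ => k₃ b c
  -- The bound involves only `U`, `B` and the weak derivatives of `f`, so it is the same for every
  -- mollifier.
  let M : Fin d → ℝ := fun a => (C a / volume B).toReal
  have hM0 : 0 ≤ ∑ a, M a := Finset.sum_nonneg fun a _ => ENNReal.toReal_nonneg
  -- a sequence of mollifiers
  let ψ : ℕ → ContDiffBump (0 : EuclideanSpace ℝ (Fin d)) := fun n =>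
    ⟨1 / (n + 1) / 2, 1 / (n + 1), by positivity, half_lt_self (by positivity)⟩
  have hψ : Filter.Tendsto (fun n => (ψ n).rOut) Filter.atTop (nhds 0) :=
    tendsto_one_div_add_atTop_nhds_zero_nat
  have hgrad : ∀ n, (ψ n).rOut < r / 2 → ∀ x, Metric.closedBall x (ψ n).rOut ⊆ U →
      ‖fderiv ℝ (mollify ((ψ n).normed volume) (U.indicator f)) x‖ ≤ ∑ a, M a := by
    intro n hn x hx
    refine norm_fderiv_le_of_coordDeriv fun a => ?_
    have hφ1 : ∫⁻ t, ‖(ψ n).normed volume t‖ₑ = 1 := by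
      have := ofReal_integral_norm_eq_lintegral_enorm ((ψ n).integrable_normed (μ := volume))
      rw [← this]
      simp only [Real.norm_of_nonneg ((ψ n).nonneg_normed _), (ψ n).integral_normed,
        ENNReal.ofReal_one]
    have key := enorm_coordDeriv_mollify_mul_le hUo hU (R := R)
      (fun x hx y hy => Metric.edist_le_ediam_of_mem hx hy) hfl (h₁ a).1 (fun b => (h₂ a b).1)
      (fun b c => (h₃ a b c).1) ((h₁ a).2.1.locallyIntegrable (by norm_num))
      (fun b => (h₂ a b).2.1.locallyIntegrable (by norm_num)) (h₁ a).2.2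
      (fun b => (h₂ a b).2.2) (fun b c => (h₃ a b c).2.2)
      ((ψ n).contDiff_normed (μ := volume) (n := ⊤)) (ψ n).rOut_pos.le
      ((ψ n).tsupport_normed_eq (μ := volume)).subset hφ1 Metric.isOpen_ball.measurableSet
      (B := B) (fun y hy => ?_) hx
    · have hk : ‖coordDeriv a (mollify ((ψ n).normed volume) (U.indicator f)) x‖ₑ
          ≤ C a / volume B := (ENNReal.le_div_iff_mul_le (.inl hB0) (.inl hBt)).2 key
      have := ENNReal.toReal_mono (ENNReal.div_ne_top (hC a) hB0) hk
      simpa [M] using this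
    · refine (Metric.closedBall_subset_ball' ?_).trans hrU
      have := Metric.mem_ball.1 hy
      linarith
  have hcvx : ∀ ε : ℝ, Convex ℝ {x | Metric.closedBall x ε ⊆ U} := by
    intro ε x hx y hy s t hs ht hst z hz
    set p := z - (s • x + t • y) with hp
    have hpε : ‖p‖ ≤ ε := by rwa [hp, ← dist_eq_norm]
    have h3 := hU (hx (by simpa using hpε : x + p ∈ _)) (hy (by simpa using hpε : y + p ∈ _))
      hs ht hst
    convert h3 using 1
    rw [smul_add, smul_add, add_add_add_comm, ← add_smul, hst, one_smul, hp]
    abel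
  have hlim : ∀ x ∈ U, Filter.Tendsto
      (fun n => mollify ((ψ n).normed volume) (U.indicator f) x) Filter.atTop (nhds (f x)) := by
    intro x hx
    have hcont : Filter.Tendsto (U.indicator f) (nhds x) (nhds (f x)) := by
      refine (hfc.continuousAt (hUo.mem_nhds hx)).tendsto.congr' ?_
      filter_upwards [hUo.mem_nhds hx] with y hy
      rw [indicator_of_mem hy]
    have := ContDiffBump.convolution_tendsto_right (μ := volume) (φ := ψ) (l := Filter.atTop)
      (g := fun _ => U.indicator f) (k := fun _ => x) hψ
      (Filter.Eventually.of_forall fun _ => hfm.1) (hcont.comp Filter.tendsto_snd)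
      tendsto_const_nhds
    refine this.congr fun n => ?_
    rw [convolution_lsmul_swap, mollify_apply]
    simp only [smul_eq_mul, mul_comm]
  refine ⟨⟨∑ a, M a, hM0⟩, LipschitzOnWith.of_dist_le_mul fun x hx y hy => ?_⟩
  have hsmall : ∀ z ∈ U, ∀ᶠ n in Filter.atTop, Metric.closedBall z (ψ n).rOut ⊆ U := by
    intro z hz
    obtain ⟨δ, hδ, hδU⟩ := Metric.isOpen_iff.1 hUo z hz
    filter_upwards [hψ.eventually (gt_mem_nhds hδ)] with n hn
    exact (Metric.closedBall_subset_ball hn).trans hδU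
  refine le_of_tendsto ((hlim x hx).dist (hlim y hy)) ?_
  filter_upwards [hsmall x hx, hsmall y hy, hψ.eventually (gt_mem_nhds (half_pos hr))]
    with n hnx hny hnr
  rw [dist_comm, dist_comm x, dist_eq_norm, dist_eq_norm]
  -- The gradient bound holds only away from the boundary of `U`; that inner region is convex and
  -- contains `x` and `y` for large `n`, so the mean value inequality applies there.
  refine (hcvx (ψ n).rOut).norm_image_sub_le_of_norm_fderiv_le (𝕜 := ℝ) (fun z _ => ?_)
    (fun z hz => hgrad n hnr z hz) hnx hny
  exact (contDiff_mollify ((ψ n).contDiff_normed (n := ⊤)) (ψ n).hasCompactSupport_normed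
    hfl).differentiable (by simp) z

/-! ### Assembly -/

/-- A Lipschitz bound on each coordinate gives a Lipschitz bound in `ℝ^d`. -/
theorem LipschitzOnWith.of_euclidean_coord {α : Type*} [PseudoMetricSpace α] {d : ℕ}
    {u : α → EuclideanSpace ℝ (Fin d)} {S : Set α} {L : Fin d → ℝ≥0}
    (h : ∀ j, LipschitzOnWith (L j) (fun x => u x j) S) : LipschitzOnWith (∑ j, L j) u S := by
  refine LipschitzOnWith.of_dist_le_mul fun x hx y hy => ?_
  rw [EuclideanSpace.dist_eq]
  refine Real.sqrt_le_iff.2 ⟨by positivity, ?_⟩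
  refine (Finset.sum_sq_le_sq_sum_of_nonneg fun j _ => dist_nonneg).trans ?_
  gcongr
  push_cast
  rw [Finset.sum_mul]
  exact Finset.sum_le_sum fun j _ => (h j).dist_le_mul x hx y hy

theorem mainTheorem6 (d : ℕ) (hd1 : 1 ≤ d) (hd3 : d ≤ 3)
    (O : Set (EuclideanSpace ℝ (Fin d))) (hO : IsConvexPolygonalDomain O)
    (T : Geometry.SimplicialComplex ℝ (EuclideanSpace ℝ (Fin d))) (hT : IsTriangulation T O)
    (u : EuclideanSpace ℝ (Fin d) → EuclideanSpace ℝ (Fin d))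
    (hu : ContinuousOn u (closure O))
    (hu3 : ∀ K ∈ triangulationElements T, MemSobolevVec 3 2 (interior K) u) :
    MemSobolevVec 1 ∞ O u ∧ ∃ L : ℝ≥0, LipschitzOnWith L u (closure O) := by
  have hb : Bornology.IsBounded O := by
    obtain ⟨P, hP⟩ := hO.polytope
    exact ((P.finite_toSet.isCompact_convexHull ℝ).isBounded).subset (hP ▸ subset_closure)
  have hK : ∀ K ∈ triangulationElements T, ∃ L : ℝ≥0, LipschitzOnWith L u K := by
    intro K hKT
    obtain ⟨hconv, hcomp, hne⟩ := isConvexBody_of_mem_triangulationElements hKT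
    have hKO : K ⊆ closure O := hT.sUnion_elements ▸ subset_sUnion_of_mem hKT
    have hcK : ContinuousOn u K := hu.mono hKO
    have hj : ∀ j, ∃ L : ℝ≥0, LipschitzOnWith L (fun x => u x j) (interior K) := fun j =>
      (hu3 K hKT j).exists_lipschitzOnWith hd3 isOpen_interior hconv.interior
        (hcomp.isBounded.subset interior_subset) hne
        ((PiLp.continuous_apply 2 _ j).comp_continuousOn (hcK.mono interior_subset))
    choose L hL using hj
    -- The Sobolev hypothesis concerns only the interior; continuity of `u` on `K` carries the
    -- Lipschitz bound to the boundary.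
    have hcl : closure (interior K) = K := by
      rw [hconv.closure_interior_eq_closure_of_nonempty_interior hne, hcomp.isClosed.closure_eq]
    refine ⟨∑ j, L j, ?_⟩
    have := (LipschitzOnWith.of_euclidean_coord hL).closure (by rwa [hcl])
    rwa [hcl] at this
  choose! L hL using hK
  obtain ⟨L₀, hL₀⟩ : ∃ L₀, ∀ K ∈ triangulationElements T, L K ≤ L₀ := by
    obtain ⟨L₀, h⟩ := (hT.finite_elements.image L).bddAbove
    exact ⟨L₀, fun K hK => h (mem_image_of_mem L hK)⟩
  have hLip : LipschitzOnWith L₀ u (closure O) :=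
    LipschitzOnWith.of_finite_closed_cover hO.convex.closure hu hT.finite_elements
      (fun K hK => (isConvexBody_of_mem_triangulationElements hK).2.1.isClosed)
      hT.sUnion_elements.ge
      fun K hK => ((hL K hK).weaken (hL₀ K hK)).mono inter_subset_left
  refine ⟨fun j => ?_, L₀, hLip⟩
  have hp : LipschitzWith 1 fun v : EuclideanSpace ℝ (Fin d) => v j :=
    LipschitzWith.of_dist_le_mul fun v w => by
      simpa [dist_eq_norm] using PiLp.norm_apply_le (v - w) j
  exact (hp.comp_lipschitzOnWith (hLip.mono subset_closure)).memSobolev_one_top hO.isOpen hb
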